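/- Let $\mathcal H_A,\mathcal H_B$ be finite-dimensional complex Hilbert spaces and let $\mathscr B=\{\mathcal B_x\}_{x=1}^m$, $m\ge 1$, with $\mathcal B_x=\{|\psi_{xk}\rangle\}_k$, be a family of orthonormal bases of $\mathcal H_A$. The transition graph $G(\mathscr B)$ has one vertex $(x,k)$ for each basis vector $|\psi_{xk}\rangle$ (equal vectors in different bases give different vertices); two different vertices are adjacent iff the corresponding vectors are not orthogonal. For each connected component $a$ of $G(\mathscr B)$ let $P_a=\sum_{k:\,(x,k)\in a}|\psi_{xk}\rangle\langle\psi_{xk}|$, an orthogonal projector on $\mathcal H_A$ that does not depend on $x$. Call a density operator $\rho$ on $\mathcal H_A\otimes\mathcal H_B$ a zero-uncertainty state with respect to $\mathscr B$ if for every $x$ there is a POVM $\{\Pi_{xk}\}_k$ on $\mathcal H_B$ with $\sum_k\operatorname{tr}[\rho(|\psi_{xk}\rangle\langle\psi_{xk}|\otimes\Pi_{xk})]=1$. Its component vector is $(q_a)_a$ with $q_a=\operatorname{tr}[\rho(P_a\otimes 1)]$, and it is called economical if $\rho=\sum_a(P_a\otimes 1)\rho(P_a\otimes 1)$. A state $\rho$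 on $\mathcal H_A\otimes\mathcal H_B$ can be turned into a state $\sigma$ on $\mathcal H_A\otimes\mathcal H_B$ by local operations of Bob if $\sigma=(\mathrm{id}\otimes\Lambda)(\rho)$ for some completely positive trace-preserving linear map $\Lambda$ on the operators on $\mathcal H_B$; two states are equivalent if each can be turned into the other in this way. Then: (1) every zero-uncertainty state on $\mathcal H_A\otimes\mathcal H_B$ with respect to $\mathscr B$ can be turned by local operations of Bob into an economical zero-uncertainty state with the same component vector; (2) two economical zero-uncertainty states on $\mathcal H_A\otimes\mathcal H_B$ with respect to $\mathscr B$ are equivalent if and only if they have the same component vector. -/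

import Mathlib

open scoped Kronecker ComplexOrder

noncomputable section

namespace ZeroUncertainty

variable {A B C X K : Type*}

/-- A quantum state (density operator): a positive semidefinite operator of trace one. -/
def IsState {I : Type*} [Fintype I] (ρ : Matrix I I ℂ) : Prop :=
  ρ.PosSemidef ∧ ρ.trace = 1

/-- The rank-one operator `|ψ⟩⟨ψ|`. -/
def ketBra (ψ : EuclideanSpace ℂ A) : Matrix A A ℂ :=
  Matrix.vecMulVec (fun i => ψ i) (fun i => star (ψ i))

/-- A POVM on Bob's space with outcomes in `K`. -/
def IsPOVM [Fintype B] [DecidableEq B] [Fintype K] (M : K → Matrix B B ℂ) : Prop :=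
  (∀ k, (M k).PosSemidef) ∧ ∑ k, M k = 1

/-- The probability that Bob, measuring the POVM `M`, guesses correctly the outcome of Alice's
projective measurement on the basis `b`, when they share `ρ`. -/
def guessProb [Fintype A] [Fintype B] [Fintype K] (ρ : Matrix (A × B) (A × B) ℂ)
    (b : OrthonormalBasis K ℂ (EuclideanSpace ℂ A)) (M : K → Matrix B B ℂ) : ℂ :=
  ∑ k, (ρ * (ketBra (b k) ⊗ₖ M k)).trace

/-- A zero-uncertainty state: for each basis Bob has a POVM that predicts the outcome of Alice
with certainty. -/
def IsZUS [Fintype A] [Fintype B] [DecidableEq B] [Fintype K]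
    (𝓑 : X → OrthonormalBasis K ℂ (EuclideanSpace ℂ A))
    (ρ : Matrix (A × B) (A × B) ℂ) : Prop :=
  IsState ρ ∧ ∀ x, ∃ M : K → Matrix B B ℂ, IsPOVM M ∧ guessProb ρ (𝓑 x) M = 1

/-- The transition graph of a family of bases.  The vertex `(x, k)` stands for the `k`-th vector
of the basis `𝓑 x`; distinct vertices are adjacent iff the vectors are not orthogonal. -/
def transitionGraph [Fintype A] [Fintype K]
    (𝓑 : X → OrthonormalBasis K ℂ (EuclideanSpace ℂ A)) :
    SimpleGraph (X × K) where
  Adj v w := v ≠ w ∧ inner ℂ (𝓑 v.1 v.2) (𝓑 w.1 w.2) ≠ 0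
  symm := ⟨fun _ _ h => ⟨h.1.symm, fun h0 => h.2 (inner_eq_zero_symm.mp h0)⟩⟩
  loopless := ⟨fun _ h => h.1 rfl⟩

/-- The irreducible components of a family of bases. -/
abbrev Component [Fintype A] [Fintype K]
    (𝓑 : X → OrthonormalBasis K ℂ (EuclideanSpace ℂ A)) : Type _ :=
  (transitionGraph 𝓑).ConnectedComponent

instance [Fintype A] [Fintype X] [Fintype K]
    (𝓑 : X → OrthonormalBasis K ℂ (EuclideanSpace ℂ A)) : Fintype (Component 𝓑) :=
  Fintype.ofFinite _

open Classical in
/-- The sum of `|ψ⟩⟨ψ|` over the vectors `ψ` of the basis `𝓑 x` whose vertices lie in the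
component `a`. -/
def componentProjOf [Fintype A] [Fintype K]
    (𝓑 : X → OrthonormalBasis K ℂ (EuclideanSpace ℂ A)) (x : X)
    (a : Component 𝓑) : Matrix A A ℂ :=
  ∑ k with (transitionGraph 𝓑).connectedComponentMk (x, k) = a, ketBra (𝓑 x k)

/-- The component projector `P_a`, computed in some basis of the family; see
`componentProj_eq` for the independence of the basis. -/
def componentProj [Fintype A] [Nonempty X] [Fintype K]
    (𝓑 : X → OrthonormalBasis K ℂ (EuclideanSpace ℂ A))
    (a : Component 𝓑) : Matrix A A ℂ :=
  componentProjOf 𝓑 (Classical.arbitrary X) a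

theorem sum_ketBra [Fintype A] [DecidableEq A] [Fintype K]
    (b : OrthonormalBasis K ℂ (EuclideanSpace ℂ A)) :
    ∑ k, ketBra (b k) = 1 := by
  ext i j
  have h := b.sum_inner_mul_inner (EuclideanSpace.single i (1 : ℂ)) (EuclideanSpace.single j 1)
  simpa [ketBra, Matrix.sum_apply, Matrix.vecMulVec_apply, Matrix.one_apply,
    EuclideanSpace.inner_single_left, EuclideanSpace.inner_single_right, eq_comm] using h

theorem ketBra_mul_ketBra_of_inner_eq_zero [Fintype A] {φ ψ : EuclideanSpace ℂ A}
    (h : inner ℂ φ ψ = 0) : ketBra φ * ketBra ψ = 0 := by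
  have h' : (fun i => star (φ i)) ⬝ᵥ (fun i => ψ i) = 0 := by
    rw [← h, EuclideanSpace.inner_eq_star_dotProduct, dotProduct_comm]
    rfl
  rw [ketBra, ketBra, Matrix.vecMulVec_mul_vecMulVec, h']
  ext i j
  simp [Matrix.vecMulVec_apply]

theorem sum_componentProjOf [Fintype A] [DecidableEq A] [Fintype X] [Fintype K]
    (𝓑 : X → OrthonormalBasis K ℂ (EuclideanSpace ℂ A)) (x : X) :
    ∑ a, componentProjOf 𝓑 x a = 1 := by
  classical
  rw [← sum_ketBra (𝓑 x)]
  simp only [componentProjOf]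
  convert Finset.sum_fiberwise (Finset.univ : Finset K)
    (fun k => (transitionGraph 𝓑).connectedComponentMk (x, k)) (fun k => ketBra (𝓑 x k))

theorem componentProjOf_mul_of_ne [Fintype A] [Fintype K]
    (𝓑 : X → OrthonormalBasis K ℂ (EuclideanSpace ℂ A))
    (x y : X) {a b : Component 𝓑} (hab : a ≠ b) :
    componentProjOf 𝓑 x a * componentProjOf 𝓑 y b = 0 := by
  classical
  simp only [componentProjOf, Finset.sum_mul_sum]
  refine Finset.sum_eq_zero fun k hk => Finset.sum_eq_zero fun l hl => ?_
  simp only [Finset.mem_filter, Finset.mem_univ, true_and] at hk hl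
  refine ketBra_mul_ketBra_of_inner_eq_zero ?_
  by_contra h0
  apply hab
  rw [← hk, ← hl, SimpleGraph.ConnectedComponent.eq]
  by_cases hv : ((x, k) : X × K) = (y, l)
  · rw [hv]
  · have hadj : (transitionGraph 𝓑).Adj (x, k) (y, l) := And.intro hv h0
    exact hadj.reachable

/-- The component projector does not depend on the basis in which it is computed. -/
theorem componentProj_eq [Fintype A] [Fintype X] [Nonempty X] [Fintype K]
    (𝓑 : X → OrthonormalBasis K ℂ (EuclideanSpace ℂ A))
    (x : X) (a : Component 𝓑) : componentProj 𝓑 a = componentProjOf 𝓑 x a := by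
  classical
  have key : ∀ y z : X, componentProjOf 𝓑 y a = componentProjOf 𝓑 y a * componentProjOf 𝓑 z a ∧
      componentProjOf 𝓑 z a = componentProjOf 𝓑 y a * componentProjOf 𝓑 z a := by
    intro y z
    constructor
    · conv_lhs => rw [← mul_one (componentProjOf 𝓑 y a), ← sum_componentProjOf 𝓑 z, Finset.mul_sum]
      exact Finset.sum_eq_single a
        (fun b _ hb => componentProjOf_mul_of_ne 𝓑 y z hb.symm) (by simp)
    · conv_lhs => rw [← one_mul (componentProjOf 𝓑 z a), ← sum_componentProjOf 𝓑 y, Finset.sum_mul]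
      exact Finset.sum_eq_single a
        (fun b _ hb => componentProjOf_mul_of_ne 𝓑 y z hb) (by simp)
  exact (key _ x).1.trans (key _ x).2.symm

/-- The component vector `(q_a)_a` with `q_a = tr[ρ (P_a ⊗ 1)]`. -/
def componentVector [Fintype A] [Fintype B] [DecidableEq B] [Nonempty X] [Fintype K]
    (𝓑 : X → OrthonormalBasis K ℂ (EuclideanSpace ℂ A))
    (ρ : Matrix (A × B) (A × B) ℂ) (a : Component 𝓑) : ℂ :=
  (ρ * (componentProj 𝓑 a ⊗ₖ (1 : Matrix B B ℂ))).trace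

/-- The map that removes the coherence between different component subspaces,
`ρ ↦ ∑ a, (P_a ⊗ 1) ρ (P_a ⊗ 1)`. -/
def decohere [Fintype A] [Fintype B] [DecidableEq B] [Fintype X] [Nonempty X]
    [Fintype K] (𝓑 : X → OrthonormalBasis K ℂ (EuclideanSpace ℂ A))
    (ρ : Matrix (A × B) (A × B) ℂ) : Matrix (A × B) (A × B) ℂ :=
  ∑ a, (componentProj 𝓑 a ⊗ₖ (1 : Matrix B B ℂ)) * ρ * (componentProj 𝓑 a ⊗ₖ (1 : Matrix B B ℂ))

/-- An economical zero-uncertainty state has no coherence between component subspaces. -/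
def IsEconomicalZUS [Fintype A] [Fintype B] [DecidableEq B] [Fintype X] [Nonempty X]
    [Fintype K] (𝓑 : X → OrthonormalBasis K ℂ (EuclideanSpace ℂ A))
    (ρ : Matrix (A × B) (A × B) ℂ) : Prop :=
  IsZUS 𝓑 ρ ∧ decohere 𝓑 ρ = ρ

/-- `(id ⊗ Λ)(ρ)`: apply `Λ` to each block `⟨i|ρ|j⟩` of `ρ`. -/
def idTensor {I : Type*} (Λ : Matrix B B ℂ →ₗ[ℂ] Matrix C C ℂ)
    (ρ : Matrix (I × B) (I × B) ℂ) : Matrix (I × C) (I × C) ℂ :=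
  Matrix.of fun p q => Λ (Matrix.of fun b b' => ρ (p.1, b) (q.1, b')) p.2 q.2

/-- A quantum channel: a completely positive trace-preserving linear map. -/
def IsChannel [Fintype B] [Fintype C] (Λ : Matrix B B ℂ →ₗ[ℂ] Matrix C C ℂ) : Prop :=
  (∀ (n : ℕ) (M : Matrix (Fin n × B) (Fin n × B) ℂ), M.PosSemidef → (idTensor Λ M).PosSemidef) ∧
    ∀ M, (Λ M).trace = M.trace

/-- Bob can turn `ρ` into `σ` by a local operation on his space. -/
def BobConvertible [Fintype B] (ρ σ : Matrix (A × B) (A × B) ℂ) : Prop :=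
  ∃ Λ : Matrix B B ℂ →ₗ[ℂ] Matrix B B ℂ, IsChannel Λ ∧ idTensor Λ ρ = σ

/-- Two bipartite states are equivalent if Bob's local operations turn each into the other. -/
def BobEquivalent [Fintype B] (ρ σ : Matrix (A × B) (A × B) ℂ) : Prop :=
  BobConvertible ρ σ ∧ BobConvertible σ ρ

end ZeroUncertainty

end

/-! A POVM that predicts Alice's outcome with certainty acts on `ρ` exactly as her basis projectors
do (`mirrors_ketBra`). Operators of Alice that Bob can mirror are closed under products, and
nonorthogonality along a path of the transition graph makes the product of the projectors nonzero;
hence Bob mirrors every `|ψ_v⟩⟨ψ_w|` within a component (`IsZUS.exists_mirrors_outer`). The reduced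
state of Alice commutes with every mirrored operator, so it is diagonal in each basis and constant
on components, and the component vector determines it (`IsZUS.weight_eq_of_componentVector_eq`).

For the conversion (`IsZUS.bobConvertible`), fix one basis `e` and a root `r k` in the component of
each `k`. Mirroring `|e_k⟩⟨e_{r k}|`, Bob replaces his system, coherently in `k`, by the conditional
vectors `⟨e_k|h⟩` of a decomposition of `σ`. The blocks of `σ` with `k`, `l` in the same component
are restored; the others are lost, which is harmless exactly when `σ` is economical. The source need
not be economical, so part (1) is the case where `σ` is the decohered `ρ`. Conversely, channels of
Bob leave the reduced state of Alice unchanged. -/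

open scoped Kronecker ComplexOrder

noncomputable section

namespace ZeroUncertainty

open Matrix

/-! ### Kraus maps, and the invariance of Alice's marginal. -/

section Channels

variable {I B C ι : Type*}

/-- The completely positive map with Kraus operators `V i`. -/
def krausMap [Fintype B] [Fintype ι] (V : ι → Matrix C B ℂ) :
    Matrix B B ℂ →ₗ[ℂ] Matrix C C ℂ where
  toFun Y := ∑ i, V i * Y * (V i)ᴴ
  map_add' Y Z := by
    simp [Matrix.mul_add, Matrix.add_mul, Finset.sum_add_distrib]
  map_smul' c Y := by simp [Finset.smul_sum, Matrix.mul_smul, Matrix.smul_mul]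

theorem idTensor_krausMap [Fintype I] [DecidableEq I] [Fintype B] [Fintype ι]
    (V : ι → Matrix C B ℂ) (ρ : Matrix (I × B) (I × B) ℂ) :
    idTensor (krausMap V) ρ =
      ∑ i, ((1 : Matrix I I ℂ) ⊗ₖ V i) * ρ * ((1 : Matrix I I ℂ) ⊗ₖ V i)ᴴ := by
  ext p q
  simp [idTensor, krausMap, Matrix.sum_apply, Matrix.mul_apply, Fintype.sum_prod_type,
    Matrix.one_apply, ite_mul, apply_ite, Finset.sum_ite_irrel]

theorem isChannel_krausMap [Fintype B] [DecidableEq B] [Fintype C] [Fintype ι]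
    {V : ι → Matrix C B ℂ} (hV : ∑ i, (V i)ᴴ * V i = 1) : IsChannel (krausMap V) := by
  refine ⟨fun n M hM => ?_, fun M => ?_⟩
  · rw [idTensor_krausMap]
    exact Matrix.posSemidef_sum _ fun i _ => hM.mul_mul_conjTranspose_same _
  · calc (∑ i, V i * M * (V i)ᴴ).trace = (∑ i, (V i)ᴴ * V i * M).trace := by
          simp only [Matrix.trace_sum]
          exact Finset.sum_congr rfl fun i _ => by rw [Matrix.trace_mul_comm, Matrix.mul_assoc]
      _ = M.trace := by rw [← Finset.sum_mul, hV, one_mul]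

/-- Only the traces of the blocks `⟨i|ρ|j⟩` enter, and these are what a trace-preserving map keeps.
-/
theorem trace_mul_kronecker_one [Fintype I] [Fintype B] [DecidableEq B]
    (ρ : Matrix (I × B) (I × B) ℂ) (P : Matrix I I ℂ) :
    (ρ * (P ⊗ₖ (1 : Matrix B B ℂ))).trace =
      ∑ i, ∑ j, (Matrix.of fun b b' => ρ (i, b) (j, b')).trace * P j i := by
  simp only [Matrix.trace, Matrix.diag, Matrix.mul_apply, Fintype.sum_prod_type,
    Matrix.kronecker_apply, Matrix.one_apply, Matrix.of_apply, Finset.sum_mul]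
  refine Finset.sum_congr rfl fun i _ => ?_
  rw [Finset.sum_comm]
  simp

/-- A local operation of Bob does not change the expectation of Alice's observables. -/
theorem trace_idTensor_mul_kronecker_one [Fintype I] [Fintype B] [DecidableEq B] [Fintype C]
    [DecidableEq C] {Λ : Matrix B B ℂ →ₗ[ℂ] Matrix C C ℂ} (hΛ : IsChannel Λ)
    (ρ : Matrix (I × B) (I × B) ℂ) (P : Matrix I I ℂ) :
    (idTensor Λ ρ * (P ⊗ₖ (1 : Matrix C C ℂ))).trace =
      (ρ * (P ⊗ₖ (1 : Matrix B B ℂ))).trace := by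
  rw [trace_mul_kronecker_one, trace_mul_kronecker_one]
  refine Finset.sum_congr rfl fun i _ => Finset.sum_congr rfl fun j _ => ?_
  rw [← hΛ.2]
  rfl

end Channels

/-! ### Positive semidefinite matrices and the eigenvalue-one projector. -/

section PosSemidef

variable {I B : Type*} [Fintype I] [Fintype B]

theorem exists_eq_mul_conjTranspose {ρ : Matrix I I ℂ} (hρ : ρ.PosSemidef) :
    ∃ H : Matrix I I ℂ, ρ = H * Hᴴ := by
  classical
  open scoped MatrixOrder in
  obtain ⟨H, hH⟩ := CStarAlgebra.nonneg_iff_eq_mul_star_self.mp hρ.nonneg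
  exact ⟨H, hH⟩

theorem trace_mul_nonneg {ρ F : Matrix I I ℂ} (hρ : ρ.PosSemidef) (hF : F.PosSemidef) :
    0 ≤ (ρ * F).trace := by
  obtain ⟨H, rfl⟩ := exists_eq_mul_conjTranspose hρ
  rw [Matrix.mul_assoc, Matrix.trace_mul_comm]
  exact (hF.conjTranspose_mul_mul_same H).trace_nonneg

/-- With `ρ = H Hᴴ` and `F = G Gᴴ`, the trace is the squared Hilbert–Schmidt norm of `Gᴴ H`. -/
theorem mul_eq_zero_of_trace_mul_eq_zero {ρ F : Matrix I I ℂ} (hρ : ρ.PosSemidef)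
    (hF : F.PosSemidef) (h : (ρ * F).trace = 0) : F * ρ = 0 := by
  obtain ⟨H, rfl⟩ := exists_eq_mul_conjTranspose hρ
  obtain ⟨G, rfl⟩ := exists_eq_mul_conjTranspose hF
  have h0 : Gᴴ * H = 0 := by
    rw [← Matrix.trace_conjTranspose_mul_self_eq_zero_iff, ← h]
    simp only [Matrix.conjTranspose_mul, Matrix.conjTranspose_conjTranspose]
    rw [Matrix.mul_assoc, Matrix.trace_mul_comm]
    simp only [Matrix.mul_assoc]
    rw [← Matrix.mul_assoc, Matrix.trace_mul_comm]
    simp only [Matrix.mul_assoc]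
  rw [Matrix.mul_assoc, ← Matrix.mul_assoc Gᴴ, h0]
  simp

theorem posSemidef_ketBra (ψ : EuclideanSpace ℂ I) : (ketBra ψ).PosSemidef :=
  Matrix.posSemidef_vecMulVec_self_star _

/-- The eigenprojector of a Hermitian matrix for the eigenvalue one. -/
theorem exists_eigenprojector_one [DecidableEq I] {N : Matrix I I ℂ} (hN : N.IsHermitian) :
    ∃ p Z : Matrix I I ℂ, pᴴ = p ∧ p * p = p ∧ N * p = p ∧ 1 - p = Z * (1 - N) := by
  set U : Matrix I I ℂ := (hN.eigenvectorUnitary : Matrix I I ℂ)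
  have hU1 : Uᴴ * U = 1 := Unitary.coe_star_mul_self hN.eigenvectorUnitary
  have hU2 : U * Uᴴ = 1 := Unitary.coe_mul_star_self hN.eigenvectorUnitary
  set lam : I → ℂ := fun i => (hN.eigenvalues i : ℂ)
  have hNU : N = U * diagonal lam * Uᴴ := by
    conv_lhs => rw [hN.spectral_theorem]
    rfl
  have hmul : ∀ d e : I → ℂ, U * diagonal d * Uᴴ * (U * diagonal e * Uᴴ) =
      U * diagonal (fun i => d i * e i) * Uᴴ := by
    intro d e
    rw [← diagonal_mul_diagonal]
    calc _ = U * diagonal d * (Uᴴ * U) * diagonal e * Uᴴ := by simp only [Matrix.mul_assoc]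
      _ = _ := by rw [hU1]; simp only [Matrix.mul_assoc, Matrix.one_mul]
  have hsub : ∀ d : I → ℂ, 1 - U * diagonal d * Uᴴ = U * diagonal (fun i => 1 - d i) * Uᴴ := by
    intro d
    have : diagonal (fun i => 1 - d i) = 1 - diagonal d := by
      rw [← diagonal_one, diagonal_sub]
    rw [this, Matrix.mul_sub, Matrix.sub_mul, Matrix.mul_one, hU2]
  -- `Z` is the pseudoinverse of `1 - N`: the convention `0⁻¹ = 0` handles the eigenvalue one. The
  -- factorisation `1 - p = Z (1 - N)` shows that whatever `N` fixes is fixed by `p`.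
  refine ⟨U * diagonal (fun i => if lam i = 1 then 1 else 0) * Uᴴ,
    U * diagonal (fun i => (1 - lam i)⁻¹) * Uᴴ, ?_, ?_, ?_, ?_⟩
  · simp only [conjTranspose_mul, conjTranspose_conjTranspose, diagonal_conjTranspose,
      Matrix.mul_assoc]
    congr 3
    ext i
    by_cases h : lam i = 1 <;> simp [h]
  · rw [hmul]
    congr 3
    ext i
    by_cases h : lam i = 1 <;> simp [h]
  · conv_lhs => rw [hNU]
    rw [hmul]
    congr 3
    ext i
    by_cases h : lam i = 1 <;> simp [h]
  · conv_rhs => rw [hNU]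
    rw [hsub, hsub, hmul]
    congr 3
    ext i
    by_cases h : lam i = 1
    · simp [h]
    · simp [h, inv_mul_cancel₀ (sub_ne_zero.mpr (Ne.symm h))]

end PosSemidef

/-! ### Bilinearity and multiplicativity of the Kronecker product. -/

section Kronecker

variable {I J B C ι : Type*}

theorem sum_kronecker (s : Finset ι) (P : ι → Matrix I J ℂ) (Q : Matrix B C ℂ) :
    (∑ i ∈ s, P i) ⊗ₖ Q = ∑ i ∈ s, P i ⊗ₖ Q := by
  ext
  simp [Matrix.sum_apply, Finset.sum_mul]

theorem kronecker_sum (s : Finset ι) (P : Matrix I J ℂ) (Q : ι → Matrix B C ℂ) :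
    P ⊗ₖ (∑ i ∈ s, Q i) = ∑ i ∈ s, P ⊗ₖ Q i := by
  ext
  simp [Matrix.sum_apply, Finset.mul_sum]

theorem mul_kronecker_one {A B : Type*} [Fintype A] [Fintype B] [DecidableEq B]
    (X Y : Matrix A A ℂ) :
    (X * Y) ⊗ₖ (1 : Matrix B B ℂ) = (X ⊗ₖ (1 : Matrix B B ℂ)) * (Y ⊗ₖ (1 : Matrix B B ℂ)) := by
  simp [← Matrix.mul_kronecker_mul]

theorem one_kronecker_mul {A B : Type*} [Fintype A] [DecidableEq A] [Fintype B]
    (S T : Matrix B B ℂ) :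
    (1 : Matrix A A ℂ) ⊗ₖ (S * T) = ((1 : Matrix A A ℂ) ⊗ₖ S) * ((1 : Matrix A A ℂ) ⊗ₖ T) := by
  simp [← Matrix.mul_kronecker_mul]

end Kronecker

/-! ### Matrix units `|φ⟩⟨ψ|`. -/

section Outer

variable {A : Type*}

/-- The operator `|φ⟩⟨ψ|`. -/
def outer (φ ψ : EuclideanSpace ℂ A) : Matrix A A ℂ :=
  Matrix.vecMulVec (fun i => φ i) (fun i => star (ψ i))

theorem outer_self (φ : EuclideanSpace ℂ A) : outer φ φ = ketBra φ := rfl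

theorem conjTranspose_outer (φ ψ : EuclideanSpace ℂ A) : (outer φ ψ)ᴴ = outer ψ φ := by
  ext i j
  simp [outer, Matrix.vecMulVec_apply, mul_comm]

theorem outer_mul_outer [Fintype A] (φ ψ χ ω : EuclideanSpace ℂ A) :
    outer φ ψ * outer χ ω = inner ℂ ψ χ • outer φ ω := by
  rw [outer, outer, Matrix.vecMulVec_mul_vecMulVec, EuclideanSpace.inner_eq_star_dotProduct,
    dotProduct_comm]
  ext i j
  simp only [outer, Matrix.vecMulVec_apply, Matrix.smul_apply, smul_eq_mul, Pi.smul_apply]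
  rw [show (χ.ofLp ⬝ᵥ star ψ.ofLp) = ((fun i => χ i) ⬝ᵥ fun i => star (ψ i)) from rfl]
  ring

variable {K : Type*} [Fintype A] [Fintype K] (b : OrthonormalBasis K ℂ (EuclideanSpace ℂ A))

theorem outer_mul_outer_basis (φ ω : EuclideanSpace ℂ A) (k : K) :
    outer φ (b k) * outer (b k) ω = outer φ ω := by
  rw [outer_mul_outer, b.inner_eq_one, one_smul]

theorem outer_mul_outer_basis_of_ne (φ ω : EuclideanSpace ℂ A) {k l : K} (h : k ≠ l) :
    outer φ (b k) * outer (b l) ω = 0 := by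
  rw [outer_mul_outer, b.inner_eq_zero h, zero_smul]

end Outer

/-! ### Operators of Alice that Bob can mirror on a state. -/

section Mirrors

variable {A B : Type*} [Fintype A] [DecidableEq A] [Fintype B] [DecidableEq B]

/-- The operator `T` of Bob acts on `ρ` in the same way as the operator `X` of Alice, and so do
their adjoints. -/
def Mirrors (ρ : Matrix (A × B) (A × B) ℂ) (X : Matrix A A ℂ) (T : Matrix B B ℂ) : Prop :=
  (X ⊗ₖ (1 : Matrix B B ℂ)) * ρ = ((1 : Matrix A A ℂ) ⊗ₖ T) * ρ ∧
    (Xᴴ ⊗ₖ (1 : Matrix B B ℂ)) * ρ = ((1 : Matrix A A ℂ) ⊗ₖ Tᴴ) * ρ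

theorem kronecker_one_mul_one_kronecker (X : Matrix A A ℂ) (T : Matrix B B ℂ) :
    (X ⊗ₖ (1 : Matrix B B ℂ)) * ((1 : Matrix A A ℂ) ⊗ₖ T) = X ⊗ₖ T := by
  simp [← Matrix.mul_kronecker_mul]

theorem one_kronecker_mul_kronecker_one (X : Matrix A A ℂ) (T : Matrix B B ℂ) :
    ((1 : Matrix A A ℂ) ⊗ₖ T) * (X ⊗ₖ (1 : Matrix B B ℂ)) = X ⊗ₖ T := by
  simp [← Matrix.mul_kronecker_mul]

/-- The order is reversed because `Y` meets `ρ` first: once it has become `T`, it commutes with `X`,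
which then reaches `ρ` and becomes `S` to the right of `T`. -/
theorem mul_kronecker_mul_eq_of_eq {ρ : Matrix (A × B) (A × B) ℂ} {X Y : Matrix A A ℂ}
    {S T : Matrix B B ℂ}
    (hX : (X ⊗ₖ (1 : Matrix B B ℂ)) * ρ = ((1 : Matrix A A ℂ) ⊗ₖ S) * ρ)
    (hY : (Y ⊗ₖ (1 : Matrix B B ℂ)) * ρ = ((1 : Matrix A A ℂ) ⊗ₖ T) * ρ) :
    ((X * Y) ⊗ₖ (1 : Matrix B B ℂ)) * ρ = ((1 : Matrix A A ℂ) ⊗ₖ (T * S)) * ρ := by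
  rw [mul_kronecker_one, one_kronecker_mul, Matrix.mul_assoc, hY, ← Matrix.mul_assoc,
    kronecker_one_mul_one_kronecker, ← one_kronecker_mul_kronecker_one, Matrix.mul_assoc, hX,
    ← Matrix.mul_assoc]

namespace Mirrors

variable {ρ : Matrix (A × B) (A × B) ℂ} {X Y : Matrix A A ℂ} {S T : Matrix B B ℂ}

theorem mul (hX : Mirrors ρ X S) (hY : Mirrors ρ Y T) : Mirrors ρ (X * Y) (T * S) := by
  refine ⟨mul_kronecker_mul_eq_of_eq hX.1 hY.1, ?_⟩
  rw [Matrix.conjTranspose_mul, Matrix.conjTranspose_mul]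
  exact mul_kronecker_mul_eq_of_eq hY.2 hX.2

theorem smul (c : ℂ) (hX : Mirrors ρ X S) : Mirrors ρ (c • X) (c • S) := by
  refine ⟨?_, ?_⟩
  · rw [Matrix.smul_kronecker, Matrix.kronecker_smul, Matrix.smul_mul, Matrix.smul_mul, hX.1]
  · rw [Matrix.conjTranspose_smul, Matrix.conjTranspose_smul, Matrix.smul_kronecker,
      Matrix.kronecker_smul, Matrix.smul_mul, Matrix.smul_mul, hX.2]

theorem conjTranspose (hX : Mirrors ρ X S) : Mirrors ρ Xᴴ Sᴴ := by
  refine ⟨hX.2, ?_⟩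
  rw [Matrix.conjTranspose_conjTranspose, Matrix.conjTranspose_conjTranspose]
  exact hX.1

theorem mul_kronecker_one_eq (hρ : ρ.IsHermitian) (hX : Mirrors ρ X S) :
    ρ * (X ⊗ₖ (1 : Matrix B B ℂ)) = ρ * ((1 : Matrix A A ℂ) ⊗ₖ S) := by
  have h := congrArg Matrix.conjTranspose hX.2
  simpa [Matrix.conjTranspose_mul, Matrix.conjTranspose_kronecker, hρ.eq] using h

/-- This says that Alice's reduced state commutes with `X`. To the right of `ρ`, `X` turns into `S`,
which passes `Y`, goes round the trace to the left of `ρ` and turns back into `X`. -/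
theorem trace_mul_comm (hρ : ρ.IsHermitian) (hX : Mirrors ρ X S) (Y : Matrix A A ℂ) :
    (ρ * ((X * Y) ⊗ₖ (1 : Matrix B B ℂ))).trace = (ρ * ((Y * X) ⊗ₖ (1 : Matrix B B ℂ))).trace := by
  rw [mul_kronecker_one, ← Matrix.mul_assoc, hX.mul_kronecker_one_eq hρ, Matrix.mul_assoc,
    one_kronecker_mul_kronecker_one, ← kronecker_one_mul_one_kronecker, Matrix.trace_mul_comm,
    Matrix.mul_assoc, ← hX.1, ← Matrix.mul_assoc, ← mul_kronecker_one, Matrix.trace_mul_comm]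

end Mirrors

end Mirrors

/-! ### Perfect guessing makes Bob's POVM mirror Alice's basis. -/

section Guess

variable {A B K : Type*} [Fintype A] [DecidableEq A] [Fintype B] [DecidableEq B] [Fintype K]
  {ρ : Matrix (A × B) (A × B) ℂ} {b : OrthonormalBasis K ℂ (EuclideanSpace ℂ A)}
  {M : K → Matrix B B ℂ}

/-- The joint outcome probabilities are nonnegative with total one, and the diagonal ones already
sum to one, so each off-diagonal one vanishes. -/
theorem ketBra_kronecker_mul_eq_zero (hρ : IsState ρ) (hM : IsPOVM M) (hg : guessProb ρ b M = 1)
    {k l : K} (hkl : l ≠ k) : (ketBra (b l) ⊗ₖ M k) * ρ = 0 := by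
  classical
  have hpos : ∀ k l, (ketBra (b l) ⊗ₖ M k).PosSemidef := fun k l =>
    (posSemidef_ketBra _).kronecker (hM.1 k)
  have hnn : ∀ k l, 0 ≤ (ρ * (ketBra (b l) ⊗ₖ M k)).trace := fun k l =>
    trace_mul_nonneg hρ.1 (hpos k l)
  have htot : ∑ k, ∑ l, (ρ * (ketBra (b l) ⊗ₖ M k)).trace = 1 := by
    simp only [← Matrix.trace_sum, ← Finset.mul_sum, ← sum_kronecker, ← kronecker_sum, sum_ketBra,
      hM.2]
    rw [Matrix.one_kronecker_one, Matrix.mul_one, hρ.2]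
  have hoff : ∑ k, ∑ l ∈ Finset.univ.erase k, (ρ * (ketBra (b l) ⊗ₖ M k)).trace = 0 := by
    have hsplit : ∀ k, ∑ l, (ρ * (ketBra (b l) ⊗ₖ M k)).trace =
        (∑ l ∈ Finset.univ.erase k, (ρ * (ketBra (b l) ⊗ₖ M k)).trace) +
          (ρ * (ketBra (b k) ⊗ₖ M k)).trace := fun k =>
      (Finset.sum_erase_add _ _ (Finset.mem_univ k)).symm
    have hg' : ∑ k, (ρ * (ketBra (b k) ⊗ₖ M k)).trace = 1 := hg
    simp only [hsplit, Finset.sum_add_distrib, hg'] at htot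
    simpa using htot
  have h1 := (Finset.sum_eq_zero_iff_of_nonneg
    fun k _ => Finset.sum_nonneg fun l _ => hnn k l).mp hoff k (Finset.mem_univ k)
  have h2 := (Finset.sum_eq_zero_iff_of_nonneg fun l _ => hnn k l).mp h1 l
    (Finset.mem_erase.mpr ⟨hkl, Finset.mem_univ l⟩)
  exact mul_eq_zero_of_trace_mul_eq_zero hρ.1 (hpos k l) h2

/-- A measurement that predicts the outcome with certainty acts on the state as Alice's
measurement does. -/
theorem mirrors_ketBra (hρ : IsState ρ) (hM : IsPOVM M) (hg : guessProb ρ b M = 1) (k : K) :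
    Mirrors ρ (ketBra (b k)) (M k) := by
  have h : (ketBra (b k) ⊗ₖ (1 : Matrix B B ℂ)) * ρ = ((1 : Matrix A A ℂ) ⊗ₖ M k) * ρ := by
    trans (ketBra (b k) ⊗ₖ M k) * ρ
    · rw [← hM.2, kronecker_sum, Finset.sum_mul]
      exact Finset.sum_eq_single k
        (fun l _ hl => ketBra_kronecker_mul_eq_zero hρ hM hg hl.symm) (by simp)
    · rw [← sum_ketBra b, sum_kronecker, Finset.sum_mul]
      exact (Finset.sum_eq_single k
        (fun l _ hl => ketBra_kronecker_mul_eq_zero hρ hM hg hl) (by simp)).symm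
  refine ⟨h, ?_⟩
  rw [(posSemidef_ketBra (b k)).1.eq, (hM.1 k).1.eq]
  exact h

end Guess

/-! ### The reduced state of Alice in a zero-uncertainty state. -/

section ZUS

variable {A B X K : Type*} [Fintype A] [Fintype B] [DecidableEq B] [Fintype K]
  {𝓑 : X → OrthonormalBasis K ℂ (EuclideanSpace ℂ A)}
  {ρ σ : Matrix (A × B) (A × B) ℂ}

/-- The weight `⟨ψ_xk|ρ_A|ψ_xk⟩` of a basis vector in the reduced state of Alice. -/
def weight (𝓑 : X → OrthonormalBasis K ℂ (EuclideanSpace ℂ A))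
    (ρ : Matrix (A × B) (A × B) ℂ) (x : X) (k : K) : ℂ :=
  (ρ * (ketBra (𝓑 x k) ⊗ₖ (1 : Matrix B B ℂ))).trace

theorem IsState.weight_nonneg (hρ : IsState ρ) (x : X) (k : K) : 0 ≤ weight 𝓑 ρ x k :=
  trace_mul_nonneg hρ.1 ((posSemidef_ketBra _).kronecker .one)

theorem IsState.ketBra_mul_eq_zero (hρ : IsState ρ) {x : X} {k : K} (h : weight 𝓑 ρ x k = 0) :
    (ketBra (𝓑 x k) ⊗ₖ (1 : Matrix B B ℂ)) * ρ = 0 :=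
  mul_eq_zero_of_trace_mul_eq_zero hρ.1 ((posSemidef_ketBra _).kronecker .one) h

variable [DecidableEq A]

theorem IsZUS.exists_mirrors_ketBra (hρ : IsZUS 𝓑 ρ) (v : X × K) :
    ∃ T, Mirrors ρ (ketBra (𝓑 v.1 v.2)) T := by
  obtain ⟨M, hM, hg⟩ := hρ.2 v.1
  exact ⟨M v.2, mirrors_ketBra hρ.1 hM hg v.2⟩

/-- Along an edge from `u` to `v`, `|u⟩⟨u| |v⟩⟨w| = ⟨u|v⟩ |u⟩⟨w|`; adjacency allows division by the
scalar. -/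
theorem IsZUS.exists_mirrors_outer (hρ : IsZUS 𝓑 ρ) {v w : X × K}
    (h : (transitionGraph 𝓑).Reachable v w) :
    ∃ T, Mirrors ρ (outer (𝓑 v.1 v.2) (𝓑 w.1 w.2)) T := by
  obtain ⟨p⟩ := h
  induction p with
  | nil => exact hρ.exists_mirrors_ketBra _
  | @cons u v w huv _ ih =>
    obtain ⟨T, hT⟩ := ih
    obtain ⟨S, hS⟩ := hρ.exists_mirrors_ketBra u
    refine ⟨(inner ℂ (𝓑 u.1 u.2) (𝓑 v.1 v.2))⁻¹ • (T * S), ?_⟩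
    have h := (hS.mul hT).smul (inner ℂ (𝓑 u.1 u.2) (𝓑 v.1 v.2))⁻¹
    rwa [← outer_self, outer_mul_outer, smul_smul, inv_mul_cancel₀ huv.2, one_smul] at h

/-- The reduced state commutes with each `|ψ_xk⟩⟨ψ_xk|`, hence is diagonal in the basis. -/
theorem IsZUS.trace_mul_outer_of_ne (hρ : IsZUS 𝓑 ρ) (x : X) {k l : K} (hkl : k ≠ l) :
    (ρ * (outer (𝓑 x k) (𝓑 x l) ⊗ₖ (1 : Matrix B B ℂ))).trace = 0 := by
  obtain ⟨T, hT⟩ := hρ.exists_mirrors_ketBra (x, k)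
  rw [← outer_mul_outer_basis (𝓑 x) (𝓑 x k) (𝓑 x l) k, outer_self,
    hT.trace_mul_comm hρ.1.1.1, ← outer_self, outer_mul_outer_basis_of_ne _ _ _ hkl.symm]
  simp

theorem IsZUS.trace_mul_outer [DecidableEq K] (hρ : IsZUS 𝓑 ρ) (x : X) (k l : K) :
    (ρ * (outer (𝓑 x k) (𝓑 x l) ⊗ₖ (1 : Matrix B B ℂ))).trace =
      if k = l then weight 𝓑 ρ x k else 0 := by
  split_ifs with h
  · subst h
    rfl
  · exact hρ.trace_mul_outer_of_ne x h

/-- The reduced state commutes with `|ψ_xk⟩⟨ψ_xl|`, which forces equal diagonal entries. -/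
theorem IsZUS.weight_eq_of_reachable (hρ : IsZUS 𝓑 ρ) {x : X} {k l : K}
    (h : (transitionGraph 𝓑).Reachable (x, k) (x, l)) : weight 𝓑 ρ x k = weight 𝓑 ρ x l := by
  obtain ⟨T, hT⟩ := hρ.exists_mirrors_outer h
  have h1 := hT.trace_mul_comm hρ.1.1.1 (outer (𝓑 x l) (𝓑 x k))
  rwa [outer_mul_outer_basis, outer_mul_outer_basis] at h1

open Classical in
theorem IsZUS.componentVector_eq [Fintype X] [Nonempty X] (hρ : IsZUS 𝓑 ρ) (x : X) (k : K) :
    componentVector 𝓑 ρ ((transitionGraph 𝓑).connectedComponentMk (x, k)) =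
      (Finset.univ.filter fun l => (transitionGraph 𝓑).connectedComponentMk (x, l) =
        (transitionGraph 𝓑).connectedComponentMk (x, k)).card * weight 𝓑 ρ x k := by
  rw [componentVector, componentProj_eq 𝓑 x, componentProjOf, sum_kronecker, Finset.mul_sum,
    Matrix.trace_sum, ← nsmul_eq_mul]
  refine Finset.sum_eq_card_nsmul fun l hl => ?_
  rw [Finset.mem_filter, SimpleGraph.ConnectedComponent.eq] at hl
  exact hρ.weight_eq_of_reachable hl.2

/-- The component vector determines the weights. -/
theorem IsZUS.weight_eq_of_componentVector_eq [Fintype X] [Nonempty X] (hρ : IsZUS 𝓑 ρ)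
    (hσ : IsZUS 𝓑 σ) (h : componentVector 𝓑 ρ = componentVector 𝓑 σ) (x : X) (k : K) :
    weight 𝓑 ρ x k = weight 𝓑 σ x k := by
  classical
  have h1 := congrFun h ((transitionGraph 𝓑).connectedComponentMk (x, k))
  rw [hρ.componentVector_eq, hσ.componentVector_eq] at h1
  refine mul_left_cancel₀ (Nat.cast_ne_zero.mpr (Finset.card_ne_zero_of_mem (a := k) ?_)) h1
  simp

end ZUS

/-! ### Decoherence between the component subspaces. -/

section Decohere

variable {A B X K : Type*} [Fintype A] [Fintype B] [DecidableEq B] [Fintype K]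
  [Nonempty X] {𝓑 : X → OrthonormalBasis K ℂ (EuclideanSpace ℂ A)}
  {ρ : Matrix (A × B) (A × B) ℂ}

theorem conjTranspose_componentProj (a : Component 𝓑) :
    (componentProj 𝓑 a)ᴴ = componentProj 𝓑 a := by
  classical
  simp only [componentProj, componentProjOf, Matrix.conjTranspose_sum]
  exact Finset.sum_congr rfl fun k _ => (posSemidef_ketBra _).1.eq

theorem componentProj_mul_of_ne {a c : Component 𝓑} (h : a ≠ c) :
    componentProj 𝓑 a * componentProj 𝓑 c = 0 :=
  componentProjOf_mul_of_ne 𝓑 _ _ h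

variable [Fintype X]

theorem posSemidef_decohere (hρ : ρ.PosSemidef) : (decohere 𝓑 ρ).PosSemidef := by
  refine Matrix.posSemidef_sum _ fun a _ => ?_
  have h := hρ.mul_mul_conjTranspose_same (componentProj 𝓑 a ⊗ₖ (1 : Matrix B B ℂ))
  rwa [Matrix.conjTranspose_kronecker, conjTranspose_componentProj, Matrix.conjTranspose_one] at h

variable [DecidableEq A]

theorem sum_componentProj : ∑ a, componentProj 𝓑 a = 1 :=
  sum_componentProjOf 𝓑 _

theorem componentProj_mul_self (a : Component 𝓑) :
    componentProj 𝓑 a * componentProj 𝓑 a = componentProj 𝓑 a := by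
  conv_rhs => rw [← mul_one (componentProj 𝓑 a), ← sum_componentProj (𝓑 := 𝓑), Finset.mul_sum]
  exact (Finset.sum_eq_single a (fun c _ hc => componentProj_mul_of_ne hc.symm) (by simp)).symm

/-- Since `P_a` may be computed in the basis `x` itself, it is diagonal there. Hence decoherence
disturbs no guessing probability, in any basis of the family. -/
theorem componentProj_commute_ketBra (a : Component 𝓑) (x : X) (k : K) :
    Commute (componentProj 𝓑 a) (ketBra (𝓑 x k)) := by
  classical
  rw [componentProj_eq 𝓑 x, componentProjOf]
  refine Finset.sum_induction _ (fun P => Commute P (ketBra (𝓑 x k)))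
    (fun _ _ => Commute.add_left) (Commute.zero_left _) fun l _ => ?_
  by_cases h : l = k
  · rw [h]
  · simp only [Commute, SemiconjBy, ← outer_self, outer_mul_outer_basis_of_ne _ _ _ h,
      outer_mul_outer_basis_of_ne _ _ _ (Ne.symm h)]

theorem decohere_eq_self_of_decohere : decohere 𝓑 (decohere 𝓑 ρ) = decohere 𝓑 ρ := by
  simp only [decohere]
  refine Finset.sum_congr rfl fun a _ => ?_
  rw [Finset.mul_sum, Finset.sum_mul]
  have key : ∀ c d : Component 𝓑, componentProj 𝓑 c ⊗ₖ (1 : Matrix B B ℂ) *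
      (componentProj 𝓑 d ⊗ₖ (1 : Matrix B B ℂ) * ρ * componentProj 𝓑 d ⊗ₖ (1 : Matrix B B ℂ)) *
        componentProj 𝓑 c ⊗ₖ (1 : Matrix B B ℂ) =
      (componentProj 𝓑 c * componentProj 𝓑 d) ⊗ₖ (1 : Matrix B B ℂ) * ρ *
        (componentProj 𝓑 d * componentProj 𝓑 c) ⊗ₖ (1 : Matrix B B ℂ) := by
    intro c d
    simp only [mul_kronecker_one, Matrix.mul_assoc]
  rw [Finset.sum_eq_single a]
  · rw [key, componentProj_mul_self]
  · intro c _ hc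
    rw [key, componentProj_mul_of_ne hc.symm]
    simp
  · simp

/-- Decoherence is its own adjoint for the trace pairing, and it fixes `Y ⊗ M`. -/
theorem trace_decohere_mul {Y : Matrix A A ℂ} (hY : ∀ a, Commute (componentProj 𝓑 a) Y)
    (M : Matrix B B ℂ) :
    (decohere 𝓑 ρ * (Y ⊗ₖ M)).trace = (ρ * (Y ⊗ₖ M)).trace := by
  have h : ∀ a : Component 𝓑, (componentProj 𝓑 a ⊗ₖ (1 : Matrix B B ℂ) * ρ *
      componentProj 𝓑 a ⊗ₖ (1 : Matrix B B ℂ) * (Y ⊗ₖ M)).trace =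
      (ρ * ((componentProj 𝓑 a * Y) ⊗ₖ M)).trace := by
    intro a
    rw [Matrix.mul_assoc, Matrix.mul_assoc, Matrix.trace_mul_comm, Matrix.mul_assoc,
      ← Matrix.mul_kronecker_mul, ← Matrix.mul_kronecker_mul, Matrix.one_mul, Matrix.mul_one,
      (hY a).eq, Matrix.mul_assoc, componentProj_mul_self]
  rw [decohere, Finset.sum_mul, Matrix.trace_sum]
  simp only [h]
  rw [← Matrix.trace_sum, ← Finset.mul_sum, ← sum_kronecker, ← Finset.sum_mul, sum_componentProj,
    one_mul]

theorem IsZUS.decohere (hρ : IsZUS 𝓑 ρ) : IsEconomicalZUS 𝓑 (decohere 𝓑 ρ) := by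
  refine ⟨⟨⟨posSemidef_decohere hρ.1.1, ?_⟩, fun x => ?_⟩, decohere_eq_self_of_decohere⟩
  · have h := trace_decohere_mul (𝓑 := 𝓑) (ρ := ρ) (fun a => Commute.one_right _) 1
    rwa [Matrix.one_kronecker_one, Matrix.mul_one, Matrix.mul_one, hρ.1.2] at h
  · obtain ⟨M, hM, hg⟩ := hρ.2 x
    refine ⟨M, hM, ?_⟩
    rw [← hg]
    exact Finset.sum_congr rfl fun k _ =>
      trace_decohere_mul (fun a => componentProj_commute_ketBra a x k) _

theorem componentVector_decohere : componentVector 𝓑 (decohere 𝓑 ρ) = componentVector 𝓑 ρ := by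
  funext a
  refine trace_decohere_mul (fun c => ?_) _
  by_cases h : c = a
  · rw [h]
  · simp only [Commute, SemiconjBy, componentProj_mul_of_ne h, componentProj_mul_of_ne (Ne.symm h)]

open Classical in
theorem decohere_eq_sum_ketBra (x : X) :
    decohere 𝓑 ρ = ∑ k, ∑ l, if (transitionGraph 𝓑).connectedComponentMk (x, k) =
        (transitionGraph 𝓑).connectedComponentMk (x, l) then
      (ketBra (𝓑 x k) ⊗ₖ (1 : Matrix B B ℂ)) * ρ * (ketBra (𝓑 x l) ⊗ₖ (1 : Matrix B B ℂ))
      else 0 := by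
  have h : ∀ a, (componentProj 𝓑 a ⊗ₖ (1 : Matrix B B ℂ)) * ρ *
      (componentProj 𝓑 a ⊗ₖ (1 : Matrix B B ℂ)) =
      ∑ k, ∑ l, if (transitionGraph 𝓑).connectedComponentMk (x, k) = a then
        if (transitionGraph 𝓑).connectedComponentMk (x, l) = a then
        (ketBra (𝓑 x k) ⊗ₖ (1 : Matrix B B ℂ)) * ρ * (ketBra (𝓑 x l) ⊗ₖ (1 : Matrix B B ℂ))
        else 0 else 0 := by
    intro a
    simp only [componentProj_eq 𝓑 x, componentProjOf, sum_kronecker, Finset.sum_mul,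
      Finset.mul_sum, Finset.sum_filter]
    rw [Finset.sum_comm]
    refine Finset.sum_congr rfl fun k _ => Finset.sum_congr rfl fun l _ => ?_
    split_ifs <;> simp
  rw [decohere]
  simp only [h]
  rw [Finset.sum_comm]
  refine Finset.sum_congr rfl fun k _ => ?_
  rw [Finset.sum_comm]
  refine Finset.sum_congr rfl fun l _ => ?_
  rw [Finset.sum_ite_eq]
  simp [eq_comm]

end Decohere

/-! ### Partial inner products and tracing out Bob. -/

section PartialInner

variable {A B : Type*}

theorem outer_kronecker_vecMulVec (φ ψ : EuclideanSpace ℂ A) (g u : B → ℂ) :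
    outer φ ψ ⊗ₖ Matrix.vecMulVec g u =
      Matrix.vecMulVec (fun q : A × B => φ q.1 * g q.2) (fun q : A × B => star (ψ q.1) * u q.2) := by
  ext p q
  rw [Matrix.kronecker_apply]
  simp only [outer, Matrix.vecMulVec_apply]
  ring

variable [Fintype A] [Fintype B] [DecidableEq B]

/-- The partial inner product `⟨φ|h⟩`, a vector of Bob. -/
def partialInner (φ : EuclideanSpace ℂ A) (h : A × B → ℂ) (b : B) : ℂ :=
  ∑ i, star (φ i) * h (i, b)

theorem ketBra_kronecker_one_mulVec (φ : EuclideanSpace ℂ A) (h : A × B → ℂ) :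
    (ketBra φ ⊗ₖ (1 : Matrix B B ℂ)) *ᵥ h = fun q => φ q.1 * partialInner φ h q.2 := by
  funext q
  simp [Matrix.mulVec, dotProduct, ketBra, partialInner, Matrix.vecMulVec_apply,
    Fintype.sum_prod_type, Matrix.one_apply, Finset.mul_sum, mul_assoc]

theorem trace_mul_outer_kronecker_one (ρ : Matrix (A × B) (A × B) ℂ)
    (φ ψ : EuclideanSpace ℂ A) :
    (ρ * (outer φ ψ ⊗ₖ (1 : Matrix B B ℂ))).trace =
      ∑ c, ∑ i, ∑ j, star (ψ i) * ρ (i, c) (j, c) * φ j := by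
  rw [trace_mul_kronecker_one]
  simp only [Matrix.trace, Matrix.diag, Matrix.of_apply, outer, Finset.sum_mul,
    Matrix.vecMulVec_apply]
  rw [Finset.sum_comm]
  simp_rw [Finset.sum_comm (s := (Finset.univ : Finset B))]
  rw [Finset.sum_comm]
  refine Finset.sum_congr rfl fun i _ => Finset.sum_congr rfl fun j _ =>
    Finset.sum_congr rfl fun c _ => ?_
  ring

/-- The columns of `H` are an unnormalised ensemble for `H Hᴴ`; the Gram matrix of Bob's conditional
vectors, summed over it, is the reduced state of Alice. -/
theorem sum_star_partialInner_dotProduct {S : Type*} [Fintype S] (φ ψ : EuclideanSpace ℂ A)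
    (H : Matrix (A × B) S ℂ) :
    ∑ s, star (partialInner φ (H.col s)) ⬝ᵥ partialInner ψ (H.col s) =
      (H * Hᴴ * (outer φ ψ ⊗ₖ (1 : Matrix B B ℂ))).trace := by
  rw [trace_mul_outer_kronecker_one]
  simp only [dotProduct]
  rw [Finset.sum_comm]
  refine Finset.sum_congr rfl fun c _ => ?_
  have h : ∀ s, star (partialInner φ (H.col s)) c * partialInner ψ (H.col s) c =
      ∑ i, ∑ j, star (ψ i) * (H (i, c) s * star (H (j, c) s)) * φ j := by
    intro s
    simp only [partialInner, Pi.star_apply, star_sum, star_mul', star_star, Matrix.col_apply]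
    rw [Finset.sum_mul_sum, Finset.sum_comm]
    refine Finset.sum_congr rfl fun i _ => Finset.sum_congr rfl fun j _ => ?_
    ring
  simp only [h, Matrix.mul_apply, Matrix.conjTranspose_apply, Finset.sum_mul, Finset.mul_sum]
  rw [Finset.sum_comm]
  refine Finset.sum_congr rfl fun i _ => ?_
  rw [Finset.sum_comm]

/-- Summing over `c` traces out Bob's old system, so `ρ` survives only as a matrix element of
Alice's reduced state, while `g` and `g'` are prepared afresh. -/
theorem sum_kronecker_mul_mul_conjTranspose (φ φ' ψ ψ' : EuclideanSpace ℂ A) (g g' : B → ℂ)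
    (ρ : Matrix (A × B) (A × B) ℂ) :
    ∑ c, (outer φ ψ ⊗ₖ Matrix.vecMulVec g (Pi.single c 1)) * ρ *
        (outer φ' ψ' ⊗ₖ Matrix.vecMulVec g' (Pi.single c 1))ᴴ =
      (ρ * (outer ψ' ψ ⊗ₖ (1 : Matrix B B ℂ))).trace •
        Matrix.vecMulVec (fun q : A × B => φ q.1 * g q.2)
          (star fun q : A × B => φ' q.1 * g' q.2) := by
  rw [trace_mul_outer_kronecker_one, Finset.sum_smul]
  refine Finset.sum_congr rfl fun c _ => ?_
  have h : ((fun q : A × B => star (ψ q.1) * (Pi.single c 1 : B → ℂ) q.2) ᵥ* ρ) ⬝ᵥ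
      (star fun q : A × B => star (ψ' q.1) * (Pi.single c 1 : B → ℂ) q.2) =
      ∑ i, ∑ j, star (ψ i) * ρ (i, c) (j, c) * ψ' j := by
    simp [dotProduct, Matrix.vecMul, Fintype.sum_prod_type, Pi.single_apply, apply_ite,
      Finset.sum_mul]
    rw [Finset.sum_comm]
  rw [outer_kronecker_vecMulVec, outer_kronecker_vecMulVec, Matrix.conjTranspose_vecMulVec,
    Matrix.vecMulVec_mul, Matrix.vecMulVec_mul_vecMulVec, h, Matrix.vecMulVec_smul]

end PartialInner

/-! ### The channel converting one state into another. -/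

section Conversion

variable {A B X K : Type*} [Fintype A] [Fintype B] [DecidableEq B] [Fintype K]
  {𝓑 : X → OrthonormalBasis K ℂ (EuclideanSpace ℂ A)}
  {ρ σ : Matrix (A × B) (A × B) ℂ}

/-- The normalising factor `w ^ (-1/2)` of a weight `w ≥ 0`, which vanishes for `w = 0`. -/
def invSqrt (w : ℂ) : ℂ := ((Real.sqrt w.re)⁻¹ : ℝ)

theorem star_invSqrt (w : ℂ) : star (invSqrt w) = invSqrt w := Complex.conj_ofReal _

theorem invSqrt_mul_invSqrt_mul_self {w : ℂ} (hw : 0 ≤ w) (h : w ≠ 0) :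
    invSqrt w * invSqrt w * w = 1 := by
  obtain ⟨r, hr, rfl⟩ : ∃ r : ℝ, 0 ≤ r ∧ (r : ℂ) = w := by
    rw [Complex.nonneg_iff] at hw
    exact ⟨w.re, hw.1, Complex.ext rfl hw.2⟩
  have h' : r ≠ 0 := fun h0 => h (by rw [h0]; simp)
  rw [invSqrt, Complex.ofReal_re, ← Complex.ofReal_mul, ← Complex.ofReal_mul, ← mul_inv,
    Real.mul_self_sqrt hr, inv_mul_cancel₀ h', Complex.ofReal_one]

/-- Representatives of the vertices of one basis up to being in the same component. -/
theorem exists_root (𝓑 : X → OrthonormalBasis K ℂ (EuclideanSpace ℂ A)) (x : X) :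
    ∃ r : K → K, (∀ k, (transitionGraph 𝓑).Reachable (x, k) (x, r k)) ∧
      ∀ k l, r k = r l ↔ (transitionGraph 𝓑).Reachable (x, k) (x, l) := by
  set f : K → Component 𝓑 := fun k => (transitionGraph 𝓑).connectedComponentMk (x, k) with hf
  have hr : ∀ k, f (Set.rangeSplitting f ⟨f k, k, rfl⟩) = f k := fun k =>
    Set.apply_rangeSplitting f _
  refine ⟨fun k => Set.rangeSplitting f ⟨f k, k, rfl⟩, fun k => ?_, fun k l => ?_⟩
  · exact SimpleGraph.ConnectedComponent.exact (hr k).symm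
  · rw [← SimpleGraph.ConnectedComponent.eq]
    change _ ↔ f k = f l
    constructor
    · intro h
      rw [← hr k, ← hr l]
      exact congrArg f h
    · intro h
      simp only [h]

theorem BobConvertible.componentVector_eq [Fintype X] [Nonempty X] (h : BobConvertible ρ σ) :
    componentVector 𝓑 ρ = componentVector 𝓑 σ := by
  obtain ⟨Λ, hΛ, rfl⟩ := h
  funext a
  exact (trace_idTensor_mul_kronecker_one hΛ ρ _).symm

variable [DecidableEq A]

/-- Bob can turn a zero-uncertainty state into any economical one with the same weights: he
swaps his half of each maximally entangled component out of `ρ` and prepares the corresponding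
conditional states of `σ`. -/
theorem IsZUS.bobConvertible [Fintype X] [Nonempty X] (hρ : IsZUS 𝓑 ρ)
    (hσ : IsEconomicalZUS 𝓑 σ) (x : X) (hw : ∀ k, weight 𝓑 ρ x k = weight 𝓑 σ x k) :
    BobConvertible ρ σ := by
  classical
  obtain ⟨H, hH⟩ := exists_eq_mul_conjTranspose hσ.1.1.1
  obtain ⟨r, hr, hrr⟩ := exists_root 𝓑 x
  choose R hR using fun k => hρ.exists_mirrors_outer (hr k)
  set e := 𝓑 x
  set w := weight 𝓑 ρ x
  set t : K → ℂ := fun k => invSqrt (w k) with ht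
  have ht_star : ∀ k, star (t k) = t k := fun k => star_invSqrt _
  have ht_ne : ∀ k, w k ≠ 0 → t k * t k * w k = 1 := fun k =>
    invSqrt_mul_invSqrt_mul_self (hρ.1.weight_nonneg x k)
  have hwr : ∀ {k l}, r k = r l → w k = w l := fun h =>
    hρ.weight_eq_of_reachable ((hrr _ _).mp h)
  have hw_root : ∀ k, w (r k) = w k := fun k => (hρ.weight_eq_of_reachable (hr k)).symm
  -- The coefficient is `1` if `w k ≠ 0` and `0` otherwise. `N` would be the sum of the `Vᴴ V`
  -- without the projector `p`; it acts as the identity on `ρ` because `(R k)ᴴ * R k` mirrors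
  -- `|e_k⟩⟨e_k|`.
  set N : Matrix B B ℂ := ∑ k, (t k * t k * w k) • ((R k)ᴴ * R k) with hN
  have ht_real : ∀ k, star (t k * t k * w k) = t k * t k * w k := by
    intro k
    by_cases h : w k = 0
    · simp [h]
    · rw [ht_ne k h, star_one]
  have hNherm : N.IsHermitian := by
    rw [Matrix.IsHermitian, hN, Matrix.conjTranspose_sum]
    refine Finset.sum_congr rfl fun k _ => ?_
    rw [Matrix.conjTranspose_smul, ht_real, Matrix.conjTranspose_mul,
      Matrix.conjTranspose_conjTranspose]
  have hNρ : ((1 : Matrix A A ℂ) ⊗ₖ N) * ρ = ρ := by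
    have h1 : ∀ k, ((1 : Matrix A A ℂ) ⊗ₖ ((t k * t k * w k) • ((R k)ᴴ * R k))) * ρ =
        (ketBra (e k) ⊗ₖ (1 : Matrix B B ℂ)) * ρ := by
      intro k
      have h2 := ((hR k).mul (hR k).conjTranspose).1
      rw [conjTranspose_outer, outer_mul_outer_basis, outer_self] at h2
      rw [Matrix.kronecker_smul, Matrix.smul_mul, ← h2]
      by_cases h : w k = 0
      · rw [hρ.1.ketBra_mul_eq_zero h, smul_zero]
      · rw [ht_ne k h, one_smul]
    rw [hN, kronecker_sum, Finset.sum_mul]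
    simp only [h1]
    rw [← Finset.sum_mul, ← sum_kronecker, sum_ketBra, Matrix.one_kronecker_one, Matrix.one_mul]
  -- Off the support of `ρ` nothing controls `N`. Restricting to its eigenvalue-one space gives `p N
  -- p = p` without changing `ρ`, and the Kraus operator `1 - p` completes the channel.
  obtain ⟨p, Z, hp_herm, hp_idem, hNp, hpZ⟩ := exists_eigenprojector_one hNherm
  have hpρ' : ((1 : Matrix A A ℂ) ⊗ₖ (1 - p)) * ρ = 0 := by
    have h1 : (1 : Matrix A A ℂ) ⊗ₖ (1 - N) = 1 - (1 : Matrix A A ℂ) ⊗ₖ N := by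
      rw [eq_sub_iff_add_eq, ← Matrix.kronecker_add, sub_add_cancel, Matrix.one_kronecker_one]
    rw [hpZ, one_kronecker_mul, Matrix.mul_assoc, h1, Matrix.sub_mul, hNρ, Matrix.one_mul,
      sub_self, Matrix.mul_zero]
  have hpρ : ((1 : Matrix A A ℂ) ⊗ₖ p) * ρ = ρ := by
    have h1 : (1 : Matrix A A ℂ) ⊗ₖ (1 - p) = 1 - (1 : Matrix A A ℂ) ⊗ₖ p := by
      rw [eq_sub_iff_add_eq, ← Matrix.kronecker_add, sub_add_cancel, Matrix.one_kronecker_one]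
    rw [h1, Matrix.sub_mul, Matrix.one_mul, sub_eq_zero] at hpρ'
    exact hpρ'.symm
  set g : A × B → K → B → ℂ := fun s k => partialInner (e k) (H.col s)
  -- The index `s` runs over the columns of `H`, `c` over the basis of Bob that is traced out; the
  -- sum over `k` sits inside a single Kraus operator, so coherence within a component is kept.
  set V : Option ((A × B) × B) → Matrix B B ℂ := fun o =>
    o.elim (1 - p) fun sc =>
      ∑ k, t k • (Matrix.vecMulVec (g sc.1 k) (Pi.single sc.2 1) * (R k * p)) with hV
  have hgg : ∀ k l, ∑ s, star (g s k) ⬝ᵥ g s l = if k = l then w k else 0 := by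
    intro k l
    rw [sum_star_partialInner_dotProduct, ← hH, hσ.1.trace_mul_outer, hw]
  refine ⟨krausMap V, isChannel_krausMap ?_, ?_⟩
  · rw [Fintype.sum_option, Fintype.sum_prod_type]
    have hnone : (V none)ᴴ * V none = 1 - p := by
      change (1 - p)ᴴ * (1 - p) = 1 - p
      rw [Matrix.conjTranspose_sub, Matrix.conjTranspose_one, hp_herm, Matrix.mul_sub,
        Matrix.sub_mul, Matrix.sub_mul, Matrix.mul_one, Matrix.mul_one, Matrix.one_mul, hp_idem,
        sub_self, sub_zero]
    have hterm : ∀ k l, ∑ s, ∑ c,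
        (t k • (Matrix.vecMulVec (g s k) (Pi.single c 1) * (R k * p)))ᴴ *
          (t l • (Matrix.vecMulVec (g s l) (Pi.single c 1) * (R l * p))) =
        if k = l then p * ((t k * t k * w k) • ((R k)ᴴ * R k)) * p else 0 := by
      intro k l
      have h1 : ∀ (s : A × B), ∑ c,
          (t k • (Matrix.vecMulVec (g s k) (Pi.single c 1) * (R k * p)))ᴴ *
          (t l • (Matrix.vecMulVec (g s l) (Pi.single c 1) * (R l * p))) =
          (star (g s k) ⬝ᵥ g s l) • ((t k * t l) • ((R k * p)ᴴ * (R l * p))) := by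
        intro s
        have h2 : ∑ c : B, Matrix.vecMulVec (star (Pi.single c (1 : ℂ))) (Pi.single c (1 : ℂ)) =
            (1 : Matrix B B ℂ) := by
          ext i j
          simp [Matrix.sum_apply, Matrix.vecMulVec_apply, Pi.single_apply, Matrix.one_apply,
            apply_ite]
        have h3 : ∀ c : B, (t k • (Matrix.vecMulVec (g s k) (Pi.single c 1) * (R k * p)))ᴴ *
            (t l • (Matrix.vecMulVec (g s l) (Pi.single c 1) * (R l * p))) =
            ((star (g s k) ⬝ᵥ g s l) * (t k * t l)) • ((R k * p)ᴴ *
              Matrix.vecMulVec (star (Pi.single c (1 : ℂ))) (Pi.single c (1 : ℂ)) * (R l * p)) := by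
          intro c
          rw [Matrix.conjTranspose_smul, Matrix.conjTranspose_mul, Matrix.conjTranspose_vecMulVec,
            ht_star, Matrix.smul_mul, Matrix.mul_smul, smul_smul, Matrix.mul_assoc,
            ← Matrix.mul_assoc (Matrix.vecMulVec _ _), Matrix.vecMulVec_mul_vecMulVec,
            Matrix.vecMulVec_smul, Matrix.smul_mul, Matrix.mul_smul, smul_smul, mul_comm,
            Matrix.mul_assoc]
        simp only [h3]
        rw [← Finset.smul_sum, ← Finset.sum_mul, ← Finset.mul_sum, h2, Matrix.mul_one, smul_smul]
      simp only [h1]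
      rw [← Finset.sum_smul, hgg]
      split_ifs with hkl
      · subst hkl
        rw [smul_smul, Matrix.conjTranspose_mul, hp_herm, Matrix.mul_smul, Matrix.smul_mul,
          mul_comm]
        simp only [Matrix.mul_assoc]
      · rw [zero_smul]
    have hsome : ∑ s, ∑ c, (V (some (s, c)))ᴴ * V (some (s, c)) = p * N * p := by
      calc _ = ∑ s, ∑ c, ∑ k, ∑ l,
            (t k • (Matrix.vecMulVec (g s k) (Pi.single c 1) * (R k * p)))ᴴ *
              (t l • (Matrix.vecMulVec (g s l) (Pi.single c 1) * (R l * p))) := by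
            refine Finset.sum_congr rfl fun s _ => Finset.sum_congr rfl fun c _ => ?_
            simp only [hV, Option.elim, Matrix.conjTranspose_sum, Finset.sum_mul_sum]
        _ = ∑ k, ∑ l, ∑ s, ∑ c,
            (t k • (Matrix.vecMulVec (g s k) (Pi.single c 1) * (R k * p)))ᴴ *
              (t l • (Matrix.vecMulVec (g s l) (Pi.single c 1) * (R l * p))) := by
            simp_rw [Finset.sum_comm (s := (Finset.univ : Finset B)) (t := (Finset.univ : Finset K))]
            simp_rw [Finset.sum_comm (s := (Finset.univ : Finset (A × B)))
              (t := (Finset.univ : Finset K))]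
        _ = _ := by
            simp only [hterm, Finset.sum_ite_eq, Finset.mem_univ, if_true]
            rw [← Finset.sum_mul, ← Finset.mul_sum]
    rw [hnone, hsome, Matrix.mul_assoc, hNp, hp_idem, sub_add_cancel]
  · set D : A × B → B → K → Matrix (A × B) (A × B) ℂ := fun s c k =>
      outer (e k) (e (r k)) ⊗ₖ Matrix.vecMulVec (g s k) (Pi.single c 1) with hD
    have hVρ : ∀ s c, ((1 : Matrix A A ℂ) ⊗ₖ V (some (s, c))) * ρ = ∑ k, t k • (D s c k * ρ) := by
      intro s c
      simp only [hV, Option.elim, kronecker_sum, Finset.sum_mul]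
      refine Finset.sum_congr rfl fun k _ => ?_
      rw [Matrix.kronecker_smul, Matrix.smul_mul, one_kronecker_mul, one_kronecker_mul,
        Matrix.mul_assoc, Matrix.mul_assoc, hpρ, ← (hR k).1, ← Matrix.mul_assoc,
        one_kronecker_mul_kronecker_one]
    have hVρV : ∀ s c, ((1 : Matrix A A ℂ) ⊗ₖ V (some (s, c))) * ρ *
        ((1 : Matrix A A ℂ) ⊗ₖ V (some (s, c)))ᴴ =
        ∑ k, ∑ l, (t k * t l) • (D s c k * ρ * (D s c l)ᴴ) := by
      intro s c
      have h1 : ρ * ((1 : Matrix A A ℂ) ⊗ₖ V (some (s, c)))ᴴ = ∑ l, t l • (ρ * (D s c l)ᴴ) := by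
        have h2 := congrArg Matrix.conjTranspose (hVρ s c)
        simpa only [Matrix.conjTranspose_mul, hρ.1.1.1.eq, Matrix.conjTranspose_sum,
          Matrix.conjTranspose_smul, ht_star] using h2
      rw [hVρ, Finset.sum_mul]
      refine Finset.sum_congr rfl fun k _ => ?_
      rw [Matrix.smul_mul, Matrix.mul_assoc, h1, Finset.mul_sum, Finset.smul_sum]
      refine Finset.sum_congr rfl fun l _ => ?_
      rw [Matrix.mul_smul, smul_smul, Matrix.mul_assoc]
    -- Summing the prepared vectors over the columns of `H` rebuilds the `(k, l)` block of `σ`.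
    have hcol : ∀ k l, ∑ s, Matrix.vecMulVec (fun q : A × B => e k q.1 * g s k q.2)
        (star fun q : A × B => e l q.1 * g s l q.2) =
        (ketBra (e k) ⊗ₖ (1 : Matrix B B ℂ)) * σ * (ketBra (e l) ⊗ₖ (1 : Matrix B B ℂ)) := by
      intro k l
      have h1 : ((ketBra (e l) ⊗ₖ (1 : Matrix B B ℂ)) * H)ᴴ =
          Hᴴ * (ketBra (e l) ⊗ₖ (1 : Matrix B B ℂ)) := by
        rw [Matrix.conjTranspose_mul, Matrix.conjTranspose_kronecker, Matrix.conjTranspose_one,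
          (posSemidef_ketBra _).1.eq]
      rw [hH, ← Matrix.mul_assoc, Matrix.mul_assoc _ Hᴴ, ← h1]
      ext q q'
      rw [Matrix.sum_apply, Matrix.mul_apply]
      refine Finset.sum_congr rfl fun s _ => ?_
      have h2 : ∀ k q, e k q.1 * g s k q.2 = ((ketBra (e k) ⊗ₖ (1 : Matrix B B ℂ)) * H) q s :=
        fun k q => (congrFun (ketBra_kronecker_one_mulVec (e k) (H.col s)) q).symm
      rw [Matrix.vecMulVec_apply, Matrix.conjTranspose_apply, ← h2, ← h2, Pi.star_apply]
    have hterm : ∀ k l, ∑ s, ∑ c, (t k * t l) • (D s c k * ρ * (D s c l)ᴴ) =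
        if r k = r l then
          (ketBra (e k) ⊗ₖ (1 : Matrix B B ℂ)) * σ * (ketBra (e l) ⊗ₖ (1 : Matrix B B ℂ))
        else 0 := by
      intro k l
      simp only [hD, ← Finset.smul_sum, sum_kronecker_mul_mul_conjTranspose]
      rw [hρ.trace_mul_outer, hcol, smul_smul]
      by_cases h : r k = r l
      · rw [if_pos h.symm, if_pos h]
        -- For zero weight both sides vanish: the scalar on the left, and on the right `σ`, which
        -- has the same weights as `ρ`.
        by_cases h0 : w k = 0
        · rw [hσ.1.1.ketBra_mul_eq_zero (𝓑 := 𝓑) (x := x) (k := k) (by rw [← hw]; exact h0)]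
          simp
        · have htl : t l = t k := by simp only [ht, hwr h]
          have hwl : weight 𝓑 ρ x (r l) = w k := (hw_root l).trans (hwr h).symm
          rw [htl, hwl, ht_ne k h0, one_smul]
      · rw [if_neg (Ne.symm h), if_neg h, mul_zero, zero_smul]
    rw [idTensor_krausMap, Fintype.sum_option, Fintype.sum_prod_type]
    have hnone : ((1 : Matrix A A ℂ) ⊗ₖ V none) * ρ = 0 := hpρ'
    -- Here `σ` is replaced by its decohered form: the channel produces only the blocks within
    -- components.
    rw [hnone, Matrix.zero_mul, zero_add, ← hσ.2, decohere_eq_sum_ketBra x]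
    calc _ = ∑ s, ∑ c, ∑ k, ∑ l, (t k * t l) • (D s c k * ρ * (D s c l)ᴴ) := by
          simp only [hVρV]
      _ = ∑ k, ∑ l, ∑ s, ∑ c, (t k * t l) • (D s c k * ρ * (D s c l)ᴴ) := by
          simp_rw [Finset.sum_comm (s := (Finset.univ : Finset B)) (t := (Finset.univ : Finset K))]
          simp_rw [Finset.sum_comm (s := (Finset.univ : Finset (A × B)))
            (t := (Finset.univ : Finset K))]
      _ = _ := by
          refine Finset.sum_congr rfl fun k _ => Finset.sum_congr rfl fun l _ => ?_
          rw [hterm]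
          exact if_congr ((hrr k l).trans SimpleGraph.ConnectedComponent.eq.symm) rfl rfl

theorem IsZUS.bobConvertible_of_componentVector_eq [Fintype X] [Nonempty X] (hρ : IsZUS 𝓑 ρ)
    (hσ : IsEconomicalZUS 𝓑 σ) (h : componentVector 𝓑 ρ = componentVector 𝓑 σ) :
    BobConvertible ρ σ :=
  hρ.bobConvertible hσ (Classical.arbitrary X)
    (hρ.weight_eq_of_componentVector_eq hσ.1 h _)

end Conversion

end ZeroUncertainty

end

theorem corollary8 {A B X K : Type*} [Fintype A] [Fintype B] [DecidableEq B]
    [Fintype X] [Nonempty X] [Fintype K]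
    (𝓑 : X → OrthonormalBasis K ℂ (EuclideanSpace ℂ A)) :
    (∀ ρ : Matrix (A × B) (A × B) ℂ, ZeroUncertainty.IsZUS 𝓑 ρ →
      ∃ σ : Matrix (A × B) (A × B) ℂ, ZeroUncertainty.BobConvertible ρ σ ∧
        ZeroUncertainty.IsEconomicalZUS 𝓑 σ ∧
        ZeroUncertainty.componentVector 𝓑 σ = ZeroUncertainty.componentVector 𝓑 ρ) ∧
    (∀ ρ σ : Matrix (A × B) (A × B) ℂ, ZeroUncertainty.IsEconomicalZUS 𝓑 ρ →
      ZeroUncertainty.IsEconomicalZUS 𝓑 σ →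
      (ZeroUncertainty.BobEquivalent ρ σ ↔
        ZeroUncertainty.componentVector 𝓑 ρ = ZeroUncertainty.componentVector 𝓑 σ)) := by
  classical
  refine ⟨fun ρ hρ => ⟨ZeroUncertainty.decohere 𝓑 ρ, ?_, hρ.decohere,
    ZeroUncertainty.componentVector_decohere⟩, fun ρ σ hρ hσ => ⟨fun h => h.1.componentVector_eq,
      fun h => ⟨hρ.1.bobConvertible_of_componentVector_eq hσ h,
        hσ.1.bobConvertible_of_componentVector_eq hρ h.symm⟩⟩⟩
  exact hρ.bobConvertible_of_componentVector_eq hρ.decohere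
    ZeroUncertainty.componentVector_decohere.symm
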